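/- Let $A$ be an associative ring with $1$. Write $\mathrm{Mod}\text{-}A$ for the category of left $A$-modules and $\mathrm{Mod}\text{-}A^{op}$ for the category of right $A$-modules. A functor $T$ from one of these categories to abelian groups is coherent if it is additive and there are finitely presented modules $F,G$ and natural transformations $\mathrm{Hom}(G,-)\to\mathrm{Hom}(F,-)\to T\to 0$ that are exact at every module. A full subcategory is definable if it consists of exactly the modules $M$ with $T_\lambda(M)=0$ for all $\lambda\in\Lambda$, for some family $(T_\lambda)_{\lambda\in\Lambda}$ of coherent functors indexed by a set. Consider a family of pairs of matrices $(U_\lambda,V_\lambda)_{\lambda\in\Lambda}$ indexed by a set, with entries in $A$ and with $U_\lambda$ of size $k_\lambda\times n_\lambda$ and $V_\lambda$ of size $n_\lambda\times m_\lambda$. It defines the full subcategory $$\{M\in\mathrm{Mod}\text{-}A \mid \forall\lambda\in\Lambda\ \forall x\in M^{n_\lambda}:\ U_\lambda x=0\Rightarrow x=V_\lambda y\text{ for some }y\in M^{m_\lambda}\}$$ of $\mathrm{Mod}\text{-}A$. The transposed family $(V_\lambda^T,U_\lambda^T)_{\lambda\in\Lambda}$ defines in the same way a full subcategory of $\mathrm{Mod}\text{-}A^{op}$,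 where for a right module $N$ and a matrix $W$ the product $Wx$ with a column $x$ over $N$ has entries $(Wx)_i=\sum_j x_jW_{ij}$. Then every definable subcategory of $\mathrm{Mod}\text{-}A$ is defined by some family of pairs of matrices. For every family $(U_\lambda,V_\lambda)_{\lambda\in\Lambda}$, the subcategory of $\mathrm{Mod}\text{-}A$ that it defines and the subcategory of $\mathrm{Mod}\text{-}A^{op}$ that $(V_\lambda^T,U_\lambda^T)_{\lambda\in\Lambda}$ defines are definable. Sending a definable subcategory $\mathscr D$ of $\mathrm{Mod}\text{-}A$ defined by a family $(U_\lambda,V_\lambda)_{\lambda\in\Lambda}$ to the definable subcategory $\bar{\mathscr D}$ of $\mathrm{Mod}\text{-}A^{op}$ defined by $(V_\lambda^T,U_\lambda^T)_{\lambda\in\Lambda}$ is well defined, that is, independent of the family chosen to define $\mathscr D$, and it is a bijection between the definable subcategories of $\mathrm{Mod}\text{-}A$ and the definable subcategories of $\mathrm{Mod}\text{-}A^{op}$. -/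

import Mathlib

open CategoryTheory

universe u

/-- A functor `T : Mod-A → Ab` is coherent if it is additive and there is a sequence of natural
transformations `(G, -) → (F, -) → T → 0` with `F`, `G` finitely presented, which is exact when
evaluated at any module. -/
def IsCoherentFunctor {A : Type u} [Ring A] (T : ModuleCat.{u} A ⥤ AddCommGrpCat.{u}) : Prop :=
  T.Additive ∧
  ∃ (F G : ModuleCat.{u} A) (_ : Module.FinitePresentation A F)
    (_ : Module.FinitePresentation A G)
    (α : preadditiveCoyoneda.obj (Opposite.op G) ⟶ preadditiveCoyoneda.obj (Opposite.op F))
    (β : preadditiveCoyoneda.obj (Opposite.op F) ⟶ T),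
    ∀ M : ModuleCat.{u} A,
      Function.Exact (α.app M) (β.app M) ∧ Function.Surjective (β.app M)

/-- A full subcategory of `Mod-A` (given by its class of objects) is definable if it is the
common kernel of a family (a set) of coherent functors. -/
def IsDefinable {A : Type u} [Ring A] (D : ObjectProperty (ModuleCat.{u} A)) : Prop :=
  ∃ (Λ : Type u) (T : Λ → (ModuleCat.{u} A ⥤ AddCommGrpCat.{u})),
    (∀ l, IsCoherentFunctor (T l)) ∧
    ∀ M : ModuleCat.{u} A, D M ↔ ∀ l, Limits.IsZero ((T l).obj M)

/-- The definable subcategories of the category of left `A`-modules. Right `A`-modules are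
left `Aᵐᵒᵖ`-modules. -/
def DefinableSubcategory (A : Type u) [Ring A] : Type (u + 1) :=
  { D : ObjectProperty (ModuleCat.{u} A) // IsDefinable D }

/-- A pair of matrices of sizes `k × n` and `n × m` with entries in `A`. -/
structure MatrixPair (A : Type u) where
  /-- number of rows of `U` -/
  k : ℕ
  /-- number of columns of `U` and of rows of `V` -/
  n : ℕ
  /-- number of columns of `V` -/
  m : ℕ
  /-- the first matrix -/
  U : Matrix (Fin k) (Fin n) A
  /-- the second matrix -/
  V : Matrix (Fin n) (Fin m) A

/-- The product `W x ∈ M ^ p` of a `p × q` matrix `W` over `A` and a column `x ∈ M ^ q` with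
entries in a module `M`. -/
def matrixAct {A : Type u} [Ring A] {M : Type u} [AddCommGroup M] [Module A M] {p q : ℕ}
    (W : Matrix (Fin p) (Fin q) A) (x : Fin q → M) : Fin p → M :=
  fun i => ∑ j, W i j • x j

/-- The class of modules `M` such that, for every pair `(U, V)` in the family and every
`x ∈ M ^ n`, if `U x = 0` then `x = V y` for some `y ∈ M ^ m`. -/
def definedBy {A : Type u} [Ring A] {Λ : Type u} (P : Λ → MatrixPair A) :
    ObjectProperty (ModuleCat.{u} A) :=
  fun M => ∀ (l : Λ) (x : Fin (P l).n → M),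
    matrixAct (P l).U x = 0 → ∃ y : Fin (P l).m → M, x = matrixAct (P l).V y

/-- The pair `(Vᵀ, Uᵀ)`, with entries acting on right `A`-modules, that is, viewed in `Aᵐᵒᵖ`. -/
def MatrixPair.dual {A : Type u} (P : MatrixPair A) : MatrixPair Aᵐᵒᵖ where
  k := P.m
  n := P.n
  m := P.k
  U := P.V.transpose.map MulOpposite.op
  V := P.U.transpose.map MulOpposite.op

/-! The proof rests on the character modules `Hom(-, ℚ/ℤ)`, which exchange left and right modules.
Evaluation makes a matrix and its transpose adjoint, and `ℚ/ℤ` is an injective cogenerator, so a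
module satisfies the condition of `(U, V)` iff its character module satisfies that of `(Vᵀ, Uᵀ)`, on
either side (`holds_iff_of_pairing`). Hence a right module `N` lies in the dual of `D` iff its
character module lies in `D`. This mentions no family, so the dual is well defined. It determines
`D`, since `M` lies in `D` iff its double character module does. Surjectivity is transposing back.

Definability is matched with matrices through Yoneda: a coherent functor vanishes at `M` iff all
maps `F ⟶ M` extend along some `h : F ⟶ G`. Finite presentations of `F` and `G` turn this into a
matrix condition, and block matrices bring it to the form of a pair. -/

section Characters

/-- A homomorphism to `ℚ/ℤ` that vanishes on the kernel of `f` factors through `f`. -/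
theorem exists_character_comp_eq {X Y : Type*} [AddCommGroup X] [AddCommGroup Y] (f : X →+ Y)
    (F : X →+ AddCircle (1 : ℚ)) (h : f.ker ≤ F.ker) :
    ∃ G : Y →+ AddCircle (1 : ℚ), ∀ x, G (f x) = F x := by
  obtain ⟨G, hG⟩ := CharacterModule.dual_surjective_of_injective (R := ℤ)
    (f.range.subtype.toIntLinearMap) f.range.subtype_injective
    ((QuotientAddGroup.lift f.ker F h).comp
      (QuotientAddGroup.quotientKerEquivRange f).symm.toAddMonoidHom)
  refine ⟨G, fun x ↦ ?_⟩
  have h₁ := congr($hG (f.rangeRestrict x))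
  have h₂ : (QuotientAddGroup.quotientKerEquivRange f).symm (f.rangeRestrict x)
      = QuotientAddGroup.mk x := (AddEquiv.symm_apply_eq _).2 rfl
  refine Eq.trans h₁ ?_
  change QuotientAddGroup.lift f.ker F h
    ((QuotientAddGroup.quotientKerEquivRange f).symm (f.rangeRestrict x)) = F x
  rw [h₂]
  rfl

/-- Homomorphisms to `ℚ/ℤ` separate a point from a subgroup not containing it. -/
theorem exists_character_ne_zero {X : Type*} [AddCommGroup X] (S : AddSubgroup X) {x : X}
    (hx : x ∉ S) : ∃ F : X →+ AddCircle (1 : ℚ), (∀ s ∈ S, F s = 0) ∧ F x ≠ 0 := by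
  have hx' : (QuotientAddGroup.mk x : X ⧸ S) ≠ 0 := by
    rwa [Ne, QuotientAddGroup.eq_zero_iff]
  obtain ⟨c, hc⟩ := CharacterModule.exists_character_apply_ne_zero_of_ne_zero hx'
  let d : X ⧸ S →+ AddCircle (1 : ℚ) := c
  refine ⟨d.comp (QuotientAddGroup.mk' S), fun s hs ↦ ?_, hc⟩
  have : QuotientAddGroup.mk' S s = 0 := (QuotientAddGroup.eq_zero_iff s).2 hs
  rw [AddMonoidHom.comp_apply, this, map_zero]

theorem AddMonoidHom.apply_eq_sum_single {ι X Y : Type*} [Fintype ι] [DecidableEq ι]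
    [AddCommGroup X] [AddCommGroup Y] (F : (ι → X) →+ Y) (x : ι → X) :
    F x = ∑ i, F.comp (AddMonoidHom.single (fun _ ↦ X) i) (x i) := by
  conv_lhs => rw [← Finset.univ_sum_single x, map_sum]
  rfl

end Characters

/-! ### Transposed matrix conditions under a pairing into `ℚ/ℤ`. -/

section Pairs

/-- `M` satisfies `∀ x, U x = 0 → ∃ y, x = V y`. -/
def MatrixPair.Holds {A : Type u} [Ring A] (P : MatrixPair A) (M : Type u) [AddCommGroup M]
    [Module A M] : Prop :=
  ∀ x : Fin P.n → M, matrixAct P.U x = 0 → ∃ y : Fin P.m → M, x = matrixAct P.V y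

/-- The action of a matrix as a group homomorphism. -/
def matrixActHom {A : Type u} [Ring A] (M : Type u) [AddCommGroup M] [Module A M] {p q : ℕ}
    (W : Matrix (Fin p) (Fin q) A) : (Fin q → M) →+ (Fin p → M) where
  toFun := matrixAct W
  map_zero' := by ext; simp [matrixAct]
  map_add' x y := by ext; simp [matrixAct, Finset.sum_add_distrib]

variable {A B : Type u} [Ring A] [Ring B] {M N : Type u} [AddCommGroup M] [Module A M]
  [AddCommGroup N] [Module B N] (e : N ≃+ (M →+ AddCircle (1 : ℚ))) (τ : A → B)

/-- Adjointness of `W` and its transpose. Only the relation `he` is needed of `τ`, so both `op` and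
`unop` can serve. -/
theorem pairing_matrixAct (he : ∀ a n m, e (τ a • n) m = e n (a • m)) {p q : ℕ}
    (W : Matrix (Fin p) (Fin q) A) (x : Fin q → M) (z : Fin p → N) :
    ∑ i, e (z i) (matrixAct W x i) = ∑ j, e (matrixAct (W.transpose.map τ) z j) (x j) := by
  simp only [matrixAct, map_sum, AddMonoidHom.finsetSum_apply, Matrix.map_apply,
    Matrix.transpose_apply, he]
  exact Finset.sum_comm

/-- A module satisfies the condition of `(U, V)` if and only if its character module satisfies
that of the transposed pair. -/
theorem holds_iff_of_pairing (he : ∀ a n m, e (τ a • n) m = e n (a • m))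
    (P : MatrixPair A) (Q : MatrixPair B)
    (hQ : Q = ⟨P.m, P.n, P.k, P.V.transpose.map τ, P.U.transpose.map τ⟩) :
    P.Holds M ↔ Q.Holds N := by
  subst hQ
  constructor
  · intro hP z hz
    let F : (Fin P.n → M) →+ AddCircle (1 : ℚ) :=
      ∑ i, (e (z i)).comp (Pi.evalAddMonoidHom (fun _ ↦ M) i)
    have hF (x) : F x = ∑ i, e (z i) (x i) := by simp [F]
    -- `F` kills the kernel of `U`: there `x = V y`, and pairing `z` with `V y` is pairing `Vᵀ z =
    -- 0` with `y`. The components of `G` then solve `z = Uᵀ g`.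
    obtain ⟨G, hG⟩ := exists_character_comp_eq (matrixActHom M P.U) F fun x hx ↦ by
      obtain ⟨y, rfl⟩ := hP x hx
      change matrixAct (P.V.transpose.map τ) z = 0 at hz
      change F _ = 0
      simp [hF, pairing_matrixAct e τ he, hz]
    refine ⟨fun l ↦ e.symm (G.comp (AddMonoidHom.single (fun _ ↦ M) l)), funext fun i ↦
      e.injective (AddMonoidHom.ext fun m ↦ ?_)⟩
    have h₁ := hG (Pi.single i m)
    rw [G.apply_eq_sum_single, hF] at h₁
    have h₂ := pairing_matrixAct e τ he P.U (Pi.single i m)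
      fun l ↦ e.symm (G.comp (AddMonoidHom.single (fun _ ↦ M) l))
    simp only [AddEquiv.apply_symm_apply] at h₂
    have h₃ (w : Fin P.n → N) : ∑ j, e (w j) (Pi.single (M := fun _ ↦ M) i m j) = e (w i) m := by
      rw [Finset.sum_eq_single i] <;> simp +contextual
    rw [h₃] at h₁ h₂
    exact h₁.symm.trans h₂
  · intro hQ x hx
    by_contra hy
    -- The components `z` of a character that kills the image of `V` satisfy `Vᵀ z = 0`. So `z = Uᵀ
    -- g`, and `F x` is the pairing of `g` with `U x = 0`, a contradiction.
    obtain ⟨F, hF, hFx⟩ := exists_character_ne_zero (matrixActHom M P.V).range (x := x) fun h ↦ by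
      obtain ⟨y, rfl⟩ := h
      exact hy ⟨y, rfl⟩
    let z : Fin P.n → N := fun i ↦ e.symm (F.comp (AddMonoidHom.single (fun _ ↦ M) i))
    have hz (w) : F w = ∑ i, e (z i) (w i) := by
      rw [F.apply_eq_sum_single]
      simp only [z, AddEquiv.apply_symm_apply]
    obtain ⟨g, hg⟩ := hQ z <| funext fun j ↦ e.injective <| AddMonoidHom.ext fun m ↦ by
      have h₁ := hF _ ⟨Pi.single j m, rfl⟩
      rw [hz] at h₁
      have h₂ := (pairing_matrixAct e τ he P.V (Pi.single j m) z).symm.trans h₁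
      rw [Finset.sum_eq_single j] at h₂
      · simpa using h₂
      · simp +contextual
      · simp
    apply hFx
    change z = matrixAct (P.U.transpose.map τ) g at hg
    rw [hz, hg, ← pairing_matrixAct e τ he, hx]
    simp

end Pairs

/-! ### Character modules of left and right modules. -/

section CharacterModules

variable {A : Type u} [Ring A]

/-- The character module of a left module, as a right module. -/
def rightCharacterModule (M : ModuleCat.{u} A) : ModuleCat.{u} Aᵐᵒᵖ :=
  @ModuleCat.of Aᵐᵒᵖ _ (M →+ AddCircle (1 : ℚ)) _
    { smul a f := f.comp (DistribSMul.toAddMonoidHom M a.unop)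
      one_smul f := by ext m; exact congrArg f (one_smul A m)
      mul_smul a b f := by ext m; exact congrArg f (mul_smul b.unop a.unop m)
      smul_zero _ := rfl
      smul_add _ _ _ := rfl
      add_smul a b f := by
        ext m; exact (congrArg f (add_smul a.unop b.unop m)).trans (map_add f _ _)
      zero_smul f := by ext m; exact (congrArg f (zero_smul A m)).trans (map_zero f) }

/-- The character module of a right module, as a left module. -/
def leftCharacterModule (N : ModuleCat.{u} Aᵐᵒᵖ) : ModuleCat.{u} A :=
  @ModuleCat.of A _ (N →+ AddCircle (1 : ℚ)) _
    { smul a f := f.comp (DistribSMul.toAddMonoidHom N (MulOpposite.op a))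
      one_smul f := by ext m; exact congrArg f (one_smul Aᵐᵒᵖ m)
      mul_smul a b f := by
        ext m; exact congrArg f (mul_smul (MulOpposite.op b) (MulOpposite.op a) m)
      smul_zero _ := rfl
      smul_add _ _ _ := rfl
      add_smul a b f := by
        ext m
        exact (congrArg f (add_smul (MulOpposite.op a) (MulOpposite.op b) m)).trans (map_add f _ _)
      zero_smul f := by ext m; exact (congrArg f (zero_smul Aᵐᵒᵖ m)).trans (map_zero f) }

theorem holds_iff_dual_holds_rightCharacterModule (P : MatrixPair A) (M : ModuleCat.{u} A) :
    P.Holds M ↔ P.dual.Holds (rightCharacterModule M) :=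
  holds_iff_of_pairing (N := rightCharacterModule M)
    (AddEquiv.refl (M →+ AddCircle (1 : ℚ))) MulOpposite.op (fun _ _ _ ↦ rfl) P P.dual rfl

theorem dual_holds_iff_holds_leftCharacterModule (P : MatrixPair A) (N : ModuleCat.{u} Aᵐᵒᵖ) :
    P.dual.Holds N ↔ P.Holds (leftCharacterModule N) :=
  holds_iff_of_pairing (N := leftCharacterModule N)
    (AddEquiv.refl (N →+ AddCircle (1 : ℚ))) MulOpposite.unop (fun _ _ _ ↦ rfl) P.dual P rfl

variable {Λ : Type u} (P : Λ → MatrixPair A)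

theorem definedBy_iff_rightCharacterModule (M : ModuleCat.{u} A) :
    definedBy P M ↔ definedBy (fun l ↦ (P l).dual) (rightCharacterModule M) :=
  forall_congr' fun l ↦ holds_iff_dual_holds_rightCharacterModule (P l) M

theorem definedBy_dual_iff_leftCharacterModule (N : ModuleCat.{u} Aᵐᵒᵖ) :
    definedBy (fun l ↦ (P l).dual) N ↔ definedBy P (leftCharacterModule N) :=
  forall_congr' fun l ↦ dual_holds_iff_holds_leftCharacterModule (P l) N

end CharacterModules

/-! ### Coherent functors and extension along a morphism. -/

section Coherent

variable {A : Type u} [Ring A]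

/-- Every morphism `F ⟶ M` extends along `h : F ⟶ G`. -/
def ExtendsAlong {F G : ModuleCat.{u} A} (h : F ⟶ G) (M : ModuleCat.{u} A) : Prop :=
  ∀ φ : F ⟶ M, ∃ ψ : G ⟶ M, h ≫ ψ = φ

theorem AddCommGrpCat.isZero_iff_surjective_of_exact {X Y Z : AddCommGrpCat.{u}} {f : X ⟶ Y}
    {g : Y ⟶ Z} (hfg : Function.Exact f g) (hg : Function.Surjective g) :
    Limits.IsZero Z ↔ Function.Surjective f := by
  rw [AddCommGrpCat.isZero_iff_subsingleton]
  constructor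
  · intro _ y
    exact (hfg y).1 (Subsingleton.elim _ _)
  · intro hf
    refine subsingleton_of_forall_eq 0 fun z ↦ ?_
    obtain ⟨y, rfl⟩ := hg z
    exact (hfg y).2 (hf y)

theorem preadditiveCoyoneda_map_surjective_iff {F G : ModuleCat.{u} A} (h : F ⟶ G)
    (M : ModuleCat.{u} A) :
    Function.Surjective ((preadditiveCoyoneda.map h.op).app M) ↔ ExtendsAlong h M :=
  Iff.rfl

/-- By fullness of the Yoneda embedding, `α` is precomposition with a morphism `F ⟶ G`. -/
theorem IsCoherentFunctor.exists_extendsAlong {T : ModuleCat.{u} A ⥤ AddCommGrpCat.{u}}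
    (hT : IsCoherentFunctor T) :
    ∃ (F G : ModuleCat.{u} A) (_ : Module.FinitePresentation A F)
      (_ : Module.FinitePresentation A G) (h : F ⟶ G),
      ∀ M, Limits.IsZero (T.obj M) ↔ ExtendsAlong h M := by
  obtain ⟨-, F, G, hF, hG, α, β, h⟩ := hT
  obtain ⟨f, rfl⟩ := preadditiveCoyoneda.map_surjective α
  exact ⟨F, G, hF, hG, f.unop, fun M ↦
    (AddCommGrpCat.isZero_iff_surjective_of_exact (h M).1 (h M).2).trans
      (preadditiveCoyoneda_map_surjective_iff f.unop M)⟩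

theorem exists_isCoherentFunctor {F G : ModuleCat.{u} A} (hF : Module.FinitePresentation A F)
    (hG : Module.FinitePresentation A G) (h : F ⟶ G) :
    ∃ T : ModuleCat.{u} A ⥤ AddCommGrpCat.{u}, IsCoherentFunctor T ∧
      ∀ M, Limits.IsZero (T.obj M) ↔ ExtendsAlong h M := by
  let α := preadditiveCoyoneda.map h.op
  let β := Limits.cokernel.π α
  have hβ (M : ModuleCat.{u} A) : Function.Surjective (β.app M) :=
    (AddCommGrpCat.epi_iff_surjective _).1 inferInstance
  have hαβ (M : ModuleCat.{u} A) : Function.Exact (α.app M) (β.app M) := by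
    have hS : (ShortComplex.mk α β (Limits.cokernel.condition α)).Exact :=
      ShortComplex.exact_cokernel α
    exact (ShortComplex.ab_exact_iff_function_exact _).1
      (hS.map ((evaluation (ModuleCat.{u} A) AddCommGrpCat.{u}).obj M))
  refine ⟨Limits.cokernel α, ⟨⟨fun {X Y f g} ↦ ?_⟩, F, G, hF, hG, α, β, fun M ↦ ⟨hαβ M, hβ M⟩⟩,
    fun M ↦ (AddCommGrpCat.isZero_iff_surjective_of_exact (hαβ M) (hβ M)).trans
      (preadditiveCoyoneda_map_surjective_iff h M)⟩
  -- The cokernel inherits additivity from `Hom(F, -)` because `β` is epi at `X`.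
  rw [← cancel_epi (β.app X)]
  simp only [Preadditive.comp_add, ← β.naturality, Functor.map_add, Preadditive.add_comp]

theorem isDefinable_of_extendsAlong {D : ObjectProperty (ModuleCat.{u} A)} {Λ : Type u}
    {F G : Λ → ModuleCat.{u} A} (hF : ∀ l, Module.FinitePresentation A (F l))
    (hG : ∀ l, Module.FinitePresentation A (G l)) (h : ∀ l, F l ⟶ G l)
    (hD : ∀ M, D M ↔ ∀ l, ExtendsAlong (h l) M) : IsDefinable D := by
  choose T hT hT' using fun l ↦ exists_isCoherentFunctor (hF l) (hG l) (h l)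
  exact ⟨Λ, T, hT, fun M ↦ (hD M).trans (forall_congr' fun l ↦ (hT' l M).symm)⟩

end Coherent

/-! ### Finite presentations and matrix conditions. -/

section Presentations

variable {A : Type u} [Ring A]

theorem map_matrixAct {M N : Type u} [AddCommGroup M] [Module A M] [AddCommGroup N] [Module A N]
    (φ : M →ₗ[A] N) {p q : ℕ} (W : Matrix (Fin p) (Fin q) A) (x : Fin q → M) :
    φ ∘ matrixAct W x = matrixAct W (φ ∘ x) := by
  ext i
  simp [matrixAct]

theorem matrixAct_mul {M : Type u} [AddCommGroup M] [Module A M] {p q r : ℕ}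
    (W : Matrix (Fin p) (Fin q) A) (W' : Matrix (Fin q) (Fin r) A) (x : Fin r → M) :
    matrixAct (W * W') x = matrixAct W (matrixAct W' x) := by
  ext i
  simp only [matrixAct, Matrix.mul_apply, Finset.sum_smul, Finset.smul_sum, mul_smul]
  exact Finset.sum_comm

/-- The family `g` generates `F`, and its relations are the consequences of the rows of `U`. -/
structure IsPresentation {k n : ℕ} (U : Matrix (Fin k) (Fin n) A) {F : Type u} [AddCommGroup F]
    [Module A F] (g : Fin n → F) : Prop where
  rel : matrixAct U g = 0
  span : Submodule.span A (Set.range g) = ⊤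
  lift : ∀ {M : Type u} [AddCommGroup M] [Module A M] (x : Fin n → M), matrixAct U x = 0 →
    ∃ φ : F →ₗ[A] M, φ ∘ g = x

theorem IsPresentation.hom_ext {k n : ℕ} {U : Matrix (Fin k) (Fin n) A} {F : Type u}
    [AddCommGroup F] [Module A F] {g : Fin n → F} (hg : IsPresentation U g)
    {M : Type u} [AddCommGroup M] [Module A M] {φ ψ : F →ₗ[A] M} (h : φ ∘ g = ψ ∘ g) : φ = ψ :=
  LinearMap.ext_on_range hg.span (congrFun h)

/-- The module presented by a matrix. -/
abbrev PresentedModule {k n : ℕ} (U : Matrix (Fin k) (Fin n) A) : Type u :=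
  (Fin n → A) ⧸ Submodule.span A (Set.range U)

theorem matrixAct_eq_linearCombination {M : Type u} [AddCommGroup M] [Module A M] {p q : ℕ}
    (W : Matrix (Fin p) (Fin q) A) (x : Fin q → M) (i : Fin p) :
    matrixAct W x i = Fintype.linearCombination A x (W i) := by
  simp [matrixAct, Fintype.linearCombination_apply]

theorem LinearMap.eq_linearCombination {n : ℕ} {M : Type u} [AddCommGroup M] [Module A M]
    (f : (Fin n → A) →ₗ[A] M) : f = Fintype.linearCombination A fun i ↦ f (Pi.single i 1) := by
  refine LinearMap.pi_ext' fun i ↦ LinearMap.ext_ring ?_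
  simp [Fintype.linearCombination_apply_single]

theorem isPresentation_of_surjective {k n : ℕ} (U : Matrix (Fin k) (Fin n) A) {F : Type u}
    [AddCommGroup F] [Module A F] (f : (Fin n → A) →ₗ[A] F) (hf : Function.Surjective f)
    (hU : LinearMap.ker f = Submodule.span A (Set.range U)) :
    IsPresentation U fun i ↦ f (Pi.single i 1) where
  rel := by
    ext i
    rw [matrixAct_eq_linearCombination, ← f.eq_linearCombination, Pi.zero_apply,
      ← LinearMap.mem_ker, hU]
    exact Submodule.subset_span ⟨i, rfl⟩
  span := by
    rw [← Fintype.range_linearCombination, ← f.eq_linearCombination, LinearMap.range_eq_top.2 hf]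
  lift x hx := by
    have h : LinearMap.ker f ≤ LinearMap.ker (Fintype.linearCombination A x) := by
      rw [hU, Submodule.span_le]
      rintro _ ⟨i, rfl⟩
      exact (matrixAct_eq_linearCombination U x i).symm.trans (congrFun hx i)
    refine ⟨((LinearMap.ker f).liftQ _ h).comp (f.quotKerEquivOfSurjective hf).symm.toLinearMap,
      funext fun i ↦ ?_⟩
    have : (f.quotKerEquivOfSurjective hf).symm (f (Pi.single i 1))
        = (LinearMap.ker f).mkQ (Pi.single i 1) := (LinearEquiv.symm_apply_eq _).2 rfl
    simp [this, Fintype.linearCombination_apply_single]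

theorem exists_isPresentation (F : Type u) [AddCommGroup F] [Module A F]
    [Module.FinitePresentation A F] : ∃ (k n : ℕ) (U : Matrix (Fin k) (Fin n) A) (g : Fin n → F),
      IsPresentation U g := by
  obtain ⟨n, k, f, r, hf, hr⟩ := Module.FinitePresentation.exists_fin' A F
  refine ⟨k, n, fun i ↦ r (Pi.single i 1), _, isPresentation_of_surjective _ f hf ?_⟩
  rw [hr.linearMap_ker_eq, ← Fintype.range_linearCombination, ← r.eq_linearCombination]

theorem isPresentation_presentedModule {k n : ℕ} (U : Matrix (Fin k) (Fin n) A) :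
    IsPresentation U fun i ↦ (Submodule.mkQ (Submodule.span A (Set.range U))) (Pi.single i 1) :=
  isPresentation_of_surjective U _ (Submodule.mkQ_surjective _) (Submodule.ker_mkQ _)

theorem finitePresentation_presentedModule {k n : ℕ} (U : Matrix (Fin k) (Fin n) A) :
    Module.FinitePresentation A (PresentedModule U) :=
  Module.finitePresentation_of_surjective _ (Submodule.mkQ_surjective _) <| by
    rw [Submodule.ker_mkQ]
    exact Submodule.fg_span (Set.finite_range _)

/-- Extension along a morphism of presented modules, in terms of matrices. -/
theorem extendsAlong_iff {F G : ModuleCat.{u} A} (h : F ⟶ G) {k n l m : ℕ}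
    {U : Matrix (Fin k) (Fin n) A} {g : Fin n → F} (hg : IsPresentation U g)
    {W : Matrix (Fin l) (Fin m) A} {g' : Fin m → G} (hg' : IsPresentation W g')
    {V : Matrix (Fin n) (Fin m) A} (hV : h.hom ∘ g = matrixAct V g') (M : ModuleCat.{u} A) :
    ExtendsAlong h M ↔ ∀ x : Fin n → M, matrixAct U x = 0 →
      ∃ y : Fin m → M, matrixAct W y = 0 ∧ x = matrixAct V y := by
  constructor
  · intro hM x hx
    obtain ⟨φ, rfl⟩ := hg.lift x hx
    obtain ⟨ψ, hψ⟩ := hM (ModuleCat.ofHom φ)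
    refine ⟨ψ.hom ∘ g', ?_, ?_⟩
    · rw [← map_matrixAct, hg'.rel]
      ext; simp
    · rw [← map_matrixAct, ← hV, ← Function.comp_assoc]
      exact congrArg (fun θ : F ⟶ M ↦ θ.hom ∘ g) hψ.symm
  · intro hM φ
    obtain ⟨y, hy, hxy⟩ := hM (φ.hom ∘ g) (by
      rw [← map_matrixAct, hg.rel]
      ext; simp)
    obtain ⟨ψ, rfl⟩ := hg'.lift y hy
    refine ⟨ModuleCat.ofHom ψ, ModuleCat.hom_ext (hg.hom_ext ?_)⟩
    rw [hxy, ← map_matrixAct, ← hV]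
    rfl

/-- The morphism goes from the module presented by `U` to the one presented by `U * V`, by `g ↦ V
g'`. The relation `U V y = 0` costs nothing, as it follows from `U x = 0` and `x = V y`. -/
theorem isDefinable_definedBy {Λ : Type u} (P : Λ → MatrixPair A) : IsDefinable (definedBy P) := by
  have hg (l : Λ) := isPresentation_presentedModule (P l).U
  have hg' (l : Λ) := isPresentation_presentedModule ((P l).U * (P l).V)
  choose h hh using fun l ↦ (hg l).lift (matrixAct (P l).V _)
    ((matrixAct_mul (P l).U (P l).V _).symm.trans (hg' l).rel)
  refine isDefinable_of_extendsAlong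
    (F := fun l ↦ ModuleCat.of A (PresentedModule (P l).U))
    (G := fun l ↦ ModuleCat.of A (PresentedModule ((P l).U * (P l).V)))
    (fun l ↦ finitePresentation_presentedModule _)
    (fun l ↦ finitePresentation_presentedModule _) (fun l ↦ ModuleCat.ofHom (h l))
    fun M ↦ forall_congr' fun l ↦ ?_
  rw [extendsAlong_iff _ (hg l) (hg' l) (hh l)]
  refine forall₂_congr fun x hx ↦ exists_congr fun y ↦ ⟨fun h ↦ ⟨?_, h⟩, And.right⟩
  rw [matrixAct_mul, ← h, hx]

/-- The condition `U x = 0 → ∃ y, W y = 0 ∧ x = V y` is given by a pair of block matrices. -/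
theorem exists_matrixPair_holds_iff {k n l m : ℕ} (U : Matrix (Fin k) (Fin n) A)
    (W : Matrix (Fin l) (Fin m) A) (V : Matrix (Fin n) (Fin m) A) :
    ∃ P : MatrixPair A, ∀ (M : Type u) [AddCommGroup M] [Module A M],
      P.Holds M ↔ ∀ x : Fin n → M, matrixAct U x = 0 →
        ∃ y : Fin m → M, matrixAct W y = 0 ∧ x = matrixAct V y := by
  -- The identity block forces the `l` added coordinates to vanish, so lying in the image of `W`
  -- stacked on `V` means `W y = 0` and `x = V y`.
  refine ⟨⟨l + k, l + n, m,
    (Matrix.fromBlocks (1 : Matrix (Fin l) (Fin l) A) 0 0 U).submatrix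
      finSumFinEquiv.symm finSumFinEquiv.symm,
    (Matrix.fromRows W V).submatrix finSumFinEquiv.symm id⟩, fun M _ _ ↦ ?_⟩
  have h₁ (z : Fin l → M) (x : Fin n → M) : matrixAct
      ((Matrix.fromBlocks (1 : Matrix (Fin l) (Fin l) A) 0 0 U).submatrix
        finSumFinEquiv.symm finSumFinEquiv.symm) (Fin.append z x)
      = Fin.append z (matrixAct U x) := by
    ext i
    refine Fin.addCases (fun i ↦ ?_) (fun i ↦ ?_) i <;>
      simp [matrixAct, Fin.sum_univ_add, Matrix.one_apply]
  have h₂ (y : Fin m → M) : matrixAct ((Matrix.fromRows W V).submatrix finSumFinEquiv.symm id) y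
      = Fin.append (matrixAct W y) (matrixAct V y) := by
    ext i
    refine Fin.addCases (fun i ↦ ?_) (fun i ↦ ?_) i <;> simp [matrixAct]
  have h₃ {p q : ℕ} (a a' : Fin p → M) (b b' : Fin q → M) :
      Fin.append a b = Fin.append a' b' ↔ a = a' ∧ b = b' := by
    refine ⟨fun h ↦ ⟨funext fun i ↦ ?_, funext fun i ↦ ?_⟩, by rintro ⟨rfl, rfl⟩; rfl⟩
    · simpa using congrFun h (Fin.castAdd q i)
    · simpa using congrFun h (Fin.natAdd p i)
  have h₀ {p q : ℕ} : (0 : Fin (p + q) → M) = Fin.append 0 0 := by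
    ext i
    refine Fin.addCases (fun i ↦ ?_) (fun i ↦ ?_) i <;> simp
  constructor
  · intro hP x hx
    obtain ⟨y, hy⟩ := hP (Fin.append 0 x) (by rw [h₁, hx, h₀])
    rw [h₂, h₃] at hy
    exact ⟨y, hy.1.symm, hy.2⟩
  · intro h x hx
    obtain ⟨⟨z, x⟩, rfl⟩ := (Fin.appendEquiv l n).surjective x
    change matrixAct _ (Fin.append z x) = 0 at hx
    rw [h₁, h₀, h₃] at hx
    obtain ⟨y, hy, rfl⟩ := h x hx.2
    exact ⟨y, by rw [h₂, hy, ← hx.1]; rfl⟩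

theorem IsDefinable.exists_eq_definedBy {D : ObjectProperty (ModuleCat.{u} A)}
    (hD : IsDefinable D) : ∃ (Λ : Type u) (P : Λ → MatrixPair A), D = definedBy P := by
  obtain ⟨Λ, T, hT, hD⟩ := hD
  have key (l : Λ) : ∃ P : MatrixPair A, ∀ M : ModuleCat.{u} A,
      Limits.IsZero ((T l).obj M) ↔ P.Holds M := by
    obtain ⟨F, G, hF, hG, h, hh⟩ := (hT l).exists_extendsAlong
    obtain ⟨k, n, U, g, hg⟩ := exists_isPresentation (A := A) F
    obtain ⟨k', m, W, g', hg'⟩ := exists_isPresentation (A := A) G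
    have hV (i : Fin n) : ∃ v : Fin m → A, ∑ j, v j • g' j = h.hom (g i) := by
      rw [← Submodule.mem_span_range_iff_exists_fun, hg'.span]
      trivial
    choose V hV using hV
    obtain ⟨P, hP⟩ := exists_matrixPair_holds_iff U W V
    exact ⟨P, fun M ↦ (hh M).trans <|
      (extendsAlong_iff h hg hg' (funext fun i ↦ (hV i).symm) M).trans (hP M).symm⟩
  choose P hP using key
  exact ⟨Λ, P, funext fun M ↦ propext <| (hD M).trans <| forall_congr' fun l ↦ hP l M⟩

end Presentations

/-! ### The duality of definable subcategories. -/

theorem mainTheorem8 (A : Type u) [Ring A] :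
    -- every definable subcategory of left modules is defined by a family of matrix pairs
    (∀ D : DefinableSubcategory A,
      ∃ (Λ : Type u) (P : Λ → MatrixPair A), D.1 = definedBy P) ∧
    -- a family of matrix pairs and the transposed family define definable subcategories
    (∀ (Λ : Type u) (P : Λ → MatrixPair A),
      IsDefinable (definedBy P) ∧ IsDefinable (definedBy fun l => (P l).dual)) ∧
    -- the assignment is well defined (independent of the family) and bijective
    ∃ Φ : DefinableSubcategory A → DefinableSubcategory Aᵐᵒᵖ,
      (∀ (D : DefinableSubcategory A) (Λ : Type u) (P : Λ → MatrixPair A),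
        D.1 = definedBy P → (Φ D).1 = definedBy fun l => (P l).dual) ∧
      Function.Bijective Φ := by
  have hdual {Λ : Type u} (P : Λ → MatrixPair A) {D : ObjectProperty (ModuleCat.{u} A)}
      (hD : D = definedBy P) :
      (fun N ↦ D (leftCharacterModule N)) = definedBy fun l ↦ (P l).dual :=
    funext fun N ↦ by rw [hD, definedBy_dual_iff_leftCharacterModule]
  refine ⟨fun D ↦ D.2.exists_eq_definedBy,
    fun Λ P ↦ ⟨isDefinable_definedBy P, isDefinable_definedBy _⟩,
    fun D ↦ ⟨fun N ↦ D.1 (leftCharacterModule N), ?_⟩, fun D Λ P hD ↦ hdual P hD, ?_, ?_⟩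
  · obtain ⟨Λ, P, hP⟩ := D.2.exists_eq_definedBy
    rw [hdual P hP]
    exact isDefinable_definedBy _
  · intro D D' h
    -- Membership is tested on the double character module, hence by the dual subcategory on the
    -- character module of `M`.
    have key (E : DefinableSubcategory A) (M : ModuleCat.{u} A) :
        E.1 M ↔ E.1 (leftCharacterModule (rightCharacterModule M)) := by
      obtain ⟨Λ, P, hP⟩ := E.2.exists_eq_definedBy
      rw [hP, definedBy_iff_rightCharacterModule, definedBy_dual_iff_leftCharacterModule]
    refine Subtype.ext (funext fun M ↦ propext ?_)
    rw [key D, key D']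
    exact iff_of_eq (congrFun (congrArg Subtype.val h) (rightCharacterModule M))
  · intro E
    obtain ⟨Λ, Q, hQ⟩ := E.2.exists_eq_definedBy
    let P : Λ → MatrixPair A := fun l ↦ ⟨(Q l).m, (Q l).n, (Q l).k,
      (Q l).V.transpose.map MulOpposite.unop, (Q l).U.transpose.map MulOpposite.unop⟩
    exact ⟨⟨definedBy P, isDefinable_definedBy P⟩, Subtype.ext ((hdual P rfl).trans hQ.symm)⟩
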